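/- Consider a two-period economy with $m\ge 1$ agents $i=1,\dots,m$. The data are endowments $w_{i,0}>0$, tax rates $\tau_{i,t}\in[0,1)$, transfer shares $\gamma_{i,t}\in[0,1]$ and public investment shares $\gamma_{d,t}\in[0,1]$ with $\sum_{i=1}^m\gamma_{i,t}+\gamma_{d,t}\le 1$ ($t=0,1$), discount factors $\beta_i\in(0,1)$, and, for every $i$: - a productivity function $\mathcal A_i:\mathbb R_+\to\mathbb R_+$ that is continuous and (weakly) increasing with $\mathcal A_i(0)>0$; - a utility function $u_i$ on $\mathbb R_+$ that is continuous, real-valued on $(0,\infty)$ (the value $u_i(0)=-\infty$ is allowed), twice continuously differentiable on $(0,\infty)$, strictly increasing, strictly concave, with $u_i'(0^+)=\infty$ and $u_i'(c)+c\,u_i''(c)\ge 0$ for all $c>0$; - a production function $F_i:\mathbb R_+\to\mathbb R_+$ that is continuous, continuously differentiable on $(0,\infty)$, strictly increasing, strictly concave, with $F_i(0)=0$ and $F_i'(0^+)=\infty$. Given $T_0,T_1\ge 0$ and $0\le D_0\le T_0$, a competitive equilibrium is a list $\big((c_{i,0},c_{i,1},k_{i,1},b_{i,0})_{i=1}^m,R_1\big)$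 of real numbers such that 1. $R_1>0$; 2. for every $i$, $(c_{i,0},c_{i,1},k_{i,1},b_{i,0})$ maximizes $u_i(c_0)+\beta_i u_i(c_1)$ over all real $(c_0,c_1,k,b)$ with $c_0,c_1,k\ge 0$ and $$c_0+k\le(1-\tau_{i,0})w_{i,0}+b+\gamma_{i,0}T_0,\qquad c_1\le(1-\tau_{i,1})\mathcal A_i(D_0)F_i(k)-R_1b+\gamma_{i,1}T_1$$ (the sign of $b$ is unrestricted); 3. markets clear: $$\sum_i(c_{i,0}+k_{i,1})=\sum_i(1-\tau_{i,0})w_{i,0}+\Big(\sum_i\gamma_{i,0}\Big)T_0,$$ $$\sum_ic_{i,1}=\sum_i(1-\tau_{i,1})\mathcal A_i(D_0)F_i(k_{i,1})+\Big(\sum_i\gamma_{i,1}\Big)T_1,\qquad \sum_ib_{i,0}=0.$$ Then for all $T_0,T_1\ge0$ and $0\le D_0\le T_0$ there is a unique competitive equilibrium, and the equilibrium allocation $(c_{i,0},c_{i,1},k_{i,1},b_{i,0})_{i=1}^m$ and the interest rate $R_1$ depend continuously on $(T_0,T_1,D_0)$ on this set. -/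

import Mathlib

open Set Filter Topology

/-- The primitives of a two-period economy with `m` agents and a government; the index of type
`Fin 2` is the date. The utility `u i` takes values in the extended reals so that `u i 0 = -∞`
(for instance logarithmic utility) is covered; only its values on `[0, ∞)` matter. -/
structure Economy (m : ℕ) where
  /-- endowment at date 0 -/
  w : Fin m → ℝ
  /-- tax rates -/
  τ : Fin m → Fin 2 → ℝ
  /-- shares of the tax revenue transferred to the agents -/
  γ : Fin m → Fin 2 → ℝ
  /-- share of the tax revenue spent on public investment -/
  γd : Fin 2 → ℝ
  /-- discount factors -/
  β : Fin m → ℝ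
  /-- utility functions on `[0, ∞)` -/
  u : Fin m → ℝ → EReal
  /-- production functions on `[0, ∞)` -/
  F : Fin m → ℝ → ℝ
  /-- productivity as a function of public investment, on `[0, ∞)` -/
  A : Fin m → ℝ → ℝ

/-- A list `((c_{i,0}, c_{i,1}, k_{i,1}, b_{i,0})_i, R_1)`. -/
@[ext]
structure Outcome (m : ℕ) where
  c₀ : Fin m → ℝ
  c₁ : Fin m → ℝ
  k : Fin m → ℝ
  b : Fin m → ℝ
  R : ℝ

namespace Economy

variable {m : ℕ}

/-- Utility of agent `i` as a real function (meaningful on `(0, ∞)`, where `u i` is finite). -/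
noncomputable def util (E : Economy m) (i : Fin m) (c : ℝ) : ℝ := (E.u i c).toReal

/-- Basic assumption on productivity. -/
structure ProductivityAssumption (E : Economy m) : Prop where
  continuousOn : ∀ i, ContinuousOn (E.A i) (Ici 0)
  monotoneOn : ∀ i, MonotoneOn (E.A i) (Ici 0)
  pos_zero : ∀ i, 0 < E.A i 0

/-- Basic assumptions on endowments, policy, preferences and technology. -/
structure AgentAssumption (E : Economy m) : Prop where
  w_pos : ∀ i, 0 < E.w i
  τ_mem : ∀ i t, E.τ i t ∈ Ico (0 : ℝ) 1
  γ_mem : ∀ i t, E.γ i t ∈ Icc (0 : ℝ) 1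
  γd_mem : ∀ t, E.γd t ∈ Icc (0 : ℝ) 1
  γ_sum : ∀ t, (∑ i, E.γ i t) + E.γd t ≤ 1
  β_mem : ∀ i, E.β i ∈ Ioo (0 : ℝ) 1
  u_finite : ∀ i, ∀ c, 0 < c → E.u i c ≠ ⊥ ∧ E.u i c ≠ ⊤
  u_continuousOn : ∀ i, ContinuousOn (E.u i) (Ici 0)
  u_contDiffOn : ∀ i, ContDiffOn ℝ 2 (E.util i) (Ioi 0)
  u_strictMonoOn : ∀ i, StrictMonoOn (E.u i) (Ici 0)
  u_strictConcaveOn : ∀ i, StrictConcaveOn ℝ (Ioi 0) (E.util i)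
  u_inada : ∀ i, Tendsto (deriv (E.util i)) (𝓝[>] 0) atTop
  F_continuousOn : ∀ i, ContinuousOn (E.F i) (Ici 0)
  F_contDiffOn : ∀ i, ContDiffOn ℝ 1 (E.F i) (Ioi 0)
  F_strictMonoOn : ∀ i, StrictMonoOn (E.F i) (Ici 0)
  F_concaveOn : ∀ i, ConcaveOn ℝ (Ici 0) (E.F i)
  F_zero : ∀ i, E.F i 0 = 0

/-- Strictly concave Inada production, and `u'(c) + c u''(c) ≥ 0` for `c > 0`. -/
structure AdditionalAssumption (E : Economy m) : Prop where
  F_strictConcaveOn : ∀ i, StrictConcaveOn ℝ (Ici 0) (E.F i)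
  F_inada : ∀ i, Tendsto (deriv (E.F i)) (𝓝[>] 0) atTop
  u_elasticity : ∀ i, ∀ c, 0 < c →
    0 ≤ deriv (E.util i) c + c * deriv (deriv (E.util i)) c

/-- The constraints of agent `i` given `T₀, T₁, D₀` and the return `R`. The sign of the
borrowing `b` is free. -/
def Feasible (E : Economy m) (i : Fin m) (T₀ T₁ D₀ R c₀ c₁ k b : ℝ) : Prop :=
  c₀ + k ≤ (1 - E.τ i 0) * E.w i + b + E.γ i 0 * T₀ ∧
  c₁ ≤ (1 - E.τ i 1) * E.A i D₀ * E.F i k - R * b + E.γ i 1 * T₁ ∧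
  0 ≤ c₀ ∧ 0 ≤ c₁ ∧ 0 ≤ k

/-- Intertemporal utility of agent `i`. -/
noncomputable def objective (E : Economy m) (i : Fin m) (c₀ c₁ : ℝ) : EReal :=
  E.u i c₀ + (E.β i : EReal) * E.u i c₁

/-- `(c₀, c₁, k, b)` solves the problem of agent `i`. -/
def SolvesAgent (E : Economy m) (i : Fin m) (T₀ T₁ D₀ R c₀ c₁ k b : ℝ) : Prop :=
  E.Feasible i T₀ T₁ D₀ R c₀ c₁ k b ∧
  ∀ c₀' c₁' k' b' : ℝ, E.Feasible i T₀ T₁ D₀ R c₀' c₁' k' b' →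
    E.objective i c₀' c₁' ≤ E.objective i c₀ c₁

/-- Competitive equilibrium given `T₀, T₁, D₀`. -/
structure IsCompetitiveEquilibrium (E : Economy m) (T₀ T₁ D₀ : ℝ) (x : Outcome m) : Prop where
  R_pos : 0 < x.R
  solves : ∀ i, E.SolvesAgent i T₀ T₁ D₀ x.R (x.c₀ i) (x.c₁ i) (x.k i) (x.b i)
  good₀ : ∑ i, (x.c₀ i + x.k i) = (∑ i, (1 - E.τ i 0) * E.w i) + (∑ i, E.γ i 0) * T₀
  good₁ : ∑ i, x.c₁ i =
    (∑ i, (1 - E.τ i 1) * E.A i D₀ * E.F i (x.k i)) + (∑ i, E.γ i 1) * T₁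
  bonds : ∑ i, x.b i = 0

end Economy

/-- The triples `(T₀, T₁, D₀)` with `T₀, T₁ ≥ 0` and `0 ≤ D₀ ≤ T₀`. -/
def admissiblePolicies : Set (ℝ × ℝ × ℝ) :=
  {p | 0 ≤ p.1 ∧ 0 ≤ p.2.1 ∧ 0 ≤ p.2.2 ∧ p.2.2 ≤ p.1}

/-! At a positive return borrowing can be eliminated. The Inada conditions exclude corners, and
concavity makes the agent's problem equivalent to three equations: marginal product equal to the
return, the Euler equation, and a binding budget (`solvesAgent_of_isDemand`,
`isDemand_of_solvesAgent`). By Walras' law, equilibrium reduces to one scalar equation in `R`: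
aggregate date-0 spending on consumption and investment equals aggregate date-0 income
(`isCompetitiveEquilibrium_iff`).

Spending is strictly decreasing in `R`. Investment falls because the marginal product is decreasing.
For consumption (`IsDemand.c₀_le`), a higher `R` lowers the maximal profit and discounts date-1
income more. If `c₀` rose, the present value `c₁ / R` would therefore fall; since `c * v c` is
increasing, `R * v c₁` could not fall, while `v c₀` would, against the Euler equation. Uniqueness
follows.

Existence is the intermediate value theorem between a return at which one agent's investment alone
absorbs all income and a return at which everybody lends. Marginal products need not vanish at
infinity, so demand is only known to exist at returns no smaller than some marginal product; the
returns used are chosen accordingly. For continuity, excess demand at a fixed return close to the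
equilibrium keeps its sign under small policy changes, and monotonicity then traps the equilibrium
return; the allocation follows by continuity of demand. -/

/-! ### Marginals and technologies -/

/-- A positive, continuous, strictly decreasing function on `(0, ∞)` which blows up at `0`: the
shape of a marginal utility or of a marginal product. -/
structure IsMarginal (v : ℝ → ℝ) : Prop where
  pos : ∀ c, 0 < c → 0 < v c
  continuousOn : ContinuousOn v (Ioi 0)
  strictAntiOn : StrictAntiOn v (Ioi 0)
  inada : Tendsto v (𝓝[>] 0) atTop

/-- `F` is an increasing concave function on `[0, ∞)` vanishing at `0`, with marginal `f`;
concavity enters only through the tangent inequality. -/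
structure IsTechnology (F f : ℝ → ℝ) : Prop where
  marginal : IsMarginal f
  continuousOn : ContinuousOn F (Ici 0)
  strictMonoOn : StrictMonoOn F (Ici 0)
  map_zero : F 0 = 0
  le_tangent : ∀ x y, 0 < x → 0 ≤ y → F y ≤ F x + f x * (y - x)

/-- First-order conditions and budget identity of an agent with marginal utility `v`, discount
factor `β`, technology `a * F`, incomes `e₀`, `e₁`, facing the return `R`. -/
structure IsDemand (v F f : ℝ → ℝ) (β R a e₀ e₁ c₀ c₁ k : ℝ) : Prop where
  c₀_pos : 0 < c₀
  c₁_pos : 0 < c₁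
  k_pos : 0 < k
  marginal_product : a * f k = R
  euler : v c₀ = β * R * v c₁
  budget : c₁ = R * (e₀ - c₀ - k) + a * F k + e₁

namespace IsMarginal

variable {v : ℝ → ℝ}

theorem continuousAt (hv : IsMarginal v) {c : ℝ} (hc : 0 < c) : ContinuousAt v c :=
  hv.continuousOn.continuousAt (Ioi_mem_nhds hc)

theorem lt_of_lt (hv : IsMarginal v) {x y : ℝ} (hx : 0 < x) (hxy : x < y) : v y < v x :=
  hv.strictAntiOn hx (hx.trans hxy) hxy

theorem le_of_le (hv : IsMarginal v) {x y : ℝ} (hx : 0 < x) (hxy : x ≤ y) : v y ≤ v x :=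
  hv.strictAntiOn.antitoneOn hx (hx.trans_le hxy) hxy

/-- There are arbitrarily small points at which the marginal exceeds a given bound. -/
theorem exists_lt (hv : IsMarginal v) (M : ℝ) {δ : ℝ} (hδ : 0 < δ) :
    ∃ c, 0 < c ∧ c < δ ∧ M < v c := by
  have h := (hv.inada.eventually_gt_atTop M).and (Ioo_mem_nhdsGT hδ)
  obtain ⟨c, h1, h2⟩ := h.exists
  exact ⟨c, h2.1, h2.2, h1⟩

/-- The values of a marginal form an upward closed set. -/
theorem exists_eq (hv : IsMarginal v) {x ρ : ℝ} (hx : 0 < x) (hρ : v x ≤ ρ) :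
    ∃ c, 0 < c ∧ c ≤ x ∧ v c = ρ := by
  obtain ⟨y, hy, hyx, hyρ⟩ := hv.exists_lt ρ hx
  have hc : ContinuousOn v (Icc y x) := hv.continuousOn.mono fun z hz => hy.trans_le hz.1
  obtain ⟨c, hc, h⟩ := intermediate_value_Icc' hyx.le hc ⟨hρ, hyρ.le⟩
  exact ⟨c, hy.trans_le hc.1, hc.2, h⟩

/-- The inverse of a marginal is continuous. -/
theorem tendsto_of_tendsto_map {α : Type*} {l : Filter α} (hv : IsMarginal v) {k : α → ℝ} {k' : ℝ}
    (hk : ∀ᶠ x in l, 0 < k x) (hk' : 0 < k') (h : Tendsto (fun x => v (k x)) l (𝓝 (v k'))) :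
    Tendsto k l (𝓝 k') := by
  refine tendsto_order.2 ⟨fun y hy => ?_, fun y hy => ?_⟩
  · rcases le_or_gt y 0 with hy0 | hy0
    · exact hk.mono fun x hx => hy0.trans_lt hx
    · filter_upwards [hk, h.eventually_lt_const (hv.lt_of_lt hy0 hy)] with x hx hxy
      exact (hv.strictAntiOn.lt_iff_gt hx hy0).1 hxy
  · filter_upwards [hk, h.eventually_const_lt (hv.lt_of_lt hk' hy)] with x hx hxy
    exact (hv.strictAntiOn.lt_iff_gt (hk'.trans hy) hx).1 hxy

end IsMarginal

namespace IsTechnology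

variable {F f : ℝ → ℝ}

theorem nonneg (hF : IsTechnology F f) {k : ℝ} (hk : 0 ≤ k) : 0 ≤ F k := by
  have := hF.strictMonoOn.monotoneOn self_mem_Ici hk hk
  rwa [hF.map_zero] at this

/-- Equality of the marginal product and the return maximizes profit. -/
theorem profit_le (hF : IsTechnology F f) {a R k k' : ℝ} (ha : 0 < a) (hk : 0 < k)
    (h : a * f k = R) (hk' : 0 ≤ k') : a * F k' - R * k' ≤ a * F k - R * k := by
  have := mul_le_mul_of_nonneg_left (hF.le_tangent k k' hk hk') ha.le
  subst h
  linarith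

theorem profit_nonneg (hF : IsTechnology F f) {a R k : ℝ} (ha : 0 < a) (hk : 0 < k)
    (h : a * f k = R) : 0 ≤ a * F k - R * k := by
  simpa [hF.map_zero] using hF.profit_le ha hk h le_rfl

end IsTechnology

/-! ### Demand of a single agent -/

namespace IsDemand

variable {v F f : ℝ → ℝ} {β a e₀ e₁ : ℝ}

theorem R_pos (hF : IsTechnology F f) (ha : 0 < a) {R c₀ c₁ k : ℝ}
    (h : IsDemand v F f β R a e₀ e₁ c₀ c₁ k) : 0 < R := by
  rw [← h.marginal_product]
  exact mul_pos ha (hF.marginal.pos _ h.k_pos)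

/-- Investment is strictly decreasing in the return. -/
theorem k_lt (hF : IsTechnology F f) (ha : 0 < a) {R R' c₀ c₁ k c₀' c₁' k' : ℝ}
    (h : IsDemand v F f β R a e₀ e₁ c₀ c₁ k) (h' : IsDemand v F f β R' a e₀ e₁ c₀' c₁' k')
    (hR : R < R') : k' < k := by
  rw [← h.marginal_product, ← h'.marginal_product] at hR
  exact (hF.marginal.strictAntiOn.lt_iff_gt h.k_pos h'.k_pos).1 (lt_of_mul_lt_mul_left hR ha.le)

theorem k_le (hF : IsTechnology F f) (ha : 0 < a) {R R' c₀ c₁ k c₀' c₁' k' : ℝ}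
    (h : IsDemand v F f β R a e₀ e₁ c₀ c₁ k) (h' : IsDemand v F f β R' a e₀ e₁ c₀' c₁' k')
    (hR : R ≤ R') : k' ≤ k := by
  rw [← h.marginal_product, ← h'.marginal_product] at hR
  exact (hF.marginal.strictAntiOn.le_iff_ge h.k_pos h'.k_pos).1 (le_of_mul_le_mul_left hR ha)

/-- Under the elasticity condition, consumption at date 0 is decreasing in the return. -/
theorem c₀_le (hv : IsMarginal v) (hel : MonotoneOn (fun c => c * v c) (Ioi 0))
    (hF : IsTechnology F f) (ha : 0 < a) (hβ : 0 < β) (he₁ : 0 ≤ e₁)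
    {R R' c₀ c₁ k c₀' c₁' k' : ℝ}
    (h : IsDemand v F f β R a e₀ e₁ c₀ c₁ k) (h' : IsDemand v F f β R' a e₀ e₁ c₀' c₁' k')
    (hR : R ≤ R') : c₀' ≤ c₀ := by
  have hRpos := h.R_pos hF ha
  have hR'pos := h'.R_pos hF ha
  -- Suppose consumption rises with the return. Then `v c₀` falls strictly, so `R * v c₁` must fall
  -- strictly; comparing the present values of date-1 consumption shows that it does not.
  by_contra! hlt
  set π := a * F k - R * k with hπ
  set π' := a * F k' - R' * k' with hπ'
  have hπ'0 : 0 ≤ π' := hF.profit_nonneg ha h'.k_pos h'.marginal_product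
  have hππ : π' ≤ π := by
    have h1 := hF.profit_le ha h.k_pos h.marginal_product h'.k_pos.le
    have h2 := mul_le_mul_of_nonneg_right hR h'.k_pos.le
    linarith
  have hy : c₁ / R = e₀ - c₀ + (π + e₁) / R := by
    rw [h.budget]; field_simp; linarith
  have hy' : c₁' / R' = e₀ - c₀' + (π' + e₁) / R' := by
    rw [h'.budget]; field_simp; linarith
  -- The numerator, profit plus date-1 income, weakly falls and stays nonnegative, while the divisor
  -- rises.
  have hyy : c₁' / R' < c₁ / R := by
    have : (π' + e₁) / R' ≤ (π + e₁) / R :=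
      div_le_div₀ (by linarith) (by linarith) hRpos hR
    linarith
  have hypos : 0 < c₁' / R' := div_pos h'.c₁_pos hR'pos
  set y := c₁ / R
  set y' := c₁' / R'
  have hc₁ : c₁ = R * y := by simp only [y]; field_simp
  have hc₁' : c₁' = R' * y' := by simp only [y']; field_simp
  have hv0 := hv.lt_of_lt h.c₀_pos hlt
  rw [h.euler, h'.euler, mul_assoc, mul_assoc] at hv0
  have h1 := lt_of_mul_lt_mul_left hv0 hβ.le
  have h2 : R * v c₁ ≤ R * v (R * y') := by
    refine mul_le_mul_of_nonneg_left (hv.le_of_le (by positivity) ?_) hRpos.le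
    rw [hc₁]
    exact mul_le_mul_of_nonneg_left hyy.le hRpos.le
  -- Monotonicity of `c * v c` between `R * y'` and `R' * y'`, with the common factor `y'`
  -- cancelled.
  have h3 : R * v (R * y') ≤ R' * v c₁' := by
    have := hel (mul_pos hRpos hypos) h'.c₁_pos (by
      rw [hc₁']; exact mul_le_mul_of_nonneg_right hR hypos.le)
    simp only at this
    rw [hc₁'] at this ⊢
    refine le_of_mul_le_mul_left ?_ hypos
    linarith
  linarith

/-- The demand at a given return is unique. -/
theorem unique (hv : IsMarginal v) (hel : MonotoneOn (fun c => c * v c) (Ioi 0))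
    (hF : IsTechnology F f) (ha : 0 < a) (hβ : 0 < β) (he₁ : 0 ≤ e₁)
    {R c₀ c₁ k c₀' c₁' k' : ℝ}
    (h : IsDemand v F f β R a e₀ e₁ c₀ c₁ k) (h' : IsDemand v F f β R a e₀ e₁ c₀' c₁' k') :
    c₀ = c₀' ∧ c₁ = c₁' ∧ k = k' := by
  have hk : k = k' := (k_le hF ha h' h le_rfl).antisymm (k_le hF ha h h' le_rfl)
  have hc : c₀ = c₀' := (c₀_le hv hel hF ha hβ he₁ h' h le_rfl).antisymm
    (c₀_le hv hel hF ha hβ he₁ h h' le_rfl)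
  refine ⟨hc, ?_, hk⟩
  rw [h.budget, h'.budget, hk, hc]

/-- A demand exists as soon as the return is at least some marginal product. -/
theorem exists_of_le (hv : IsMarginal v) (hF : IsTechnology F f) (ha : 0 < a) (hβ : 0 < β)
    (he₀ : 0 < e₀) (he₁ : 0 ≤ e₁) {R x : ℝ} (hx : 0 < x) (hR : a * f x ≤ R) :
    ∃ c₀ c₁ k, IsDemand v F f β R a e₀ e₁ c₀ c₁ k := by
  have hRpos : 0 < R := (mul_pos ha (hF.marginal.pos x hx)).trans_le hR
  obtain ⟨k, hk, -, hfk⟩ := hF.marginal.exists_eq hx ((le_div_iff₀' ha).2 hR)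
  have hmp : a * f k = R := by rw [hfk]; field_simp
  set n := a * F k - R * k + e₁ with hn
  have hn0 : 0 ≤ n := add_nonneg (hF.profit_nonneg ha hk hmp) he₁
  -- `W` is lifetime wealth at date-0 prices, so the budget reads `c₁ = R * (W - c₀)`. The Euler gap
  -- is nonnegative at `x₁`, where `c₀` is small, and nonpositive at `x₂`, where `c₁ = y₂` is small.
  set W := e₀ + n / R with hW
  have hWpos : 0 < W := by positivity
  have hRW : ∀ c, R * (W - c) = R * (e₀ - c) + n := fun c => by rw [hW]; field_simp; ring
  obtain ⟨x₁, hx₁, hx₁W, hvx₁⟩ := hv.exists_lt (β * R * v (R * (W / 2))) (half_pos hWpos)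
  obtain ⟨y₂, hy₂, hy₂W, hvy₂⟩ := hv.exists_lt (v (W / 2) / (β * R))
    (mul_pos hRpos (half_pos hWpos))
  rw [div_lt_iff₀' (by positivity)] at hvy₂
  set x₂ := W - y₂ / R with hx₂
  have hyR : y₂ / R < W / 2 := by rwa [div_lt_iff₀' hRpos]
  have hyR0 : 0 < y₂ / R := by positivity
  have hx₁₂ : x₁ ≤ x₂ := by linarith
  have hcont : ContinuousOn (fun c => v c - β * R * v (R * (W - c))) (Icc x₁ x₂) := by
    refine (hv.continuousOn.mono fun z hz => hx₁.trans_le hz.1).sub (continuousOn_const.mul ?_)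
    refine hv.continuousOn.comp (by fun_prop) fun z hz => ?_
    have : z < W := by linarith [hz.2]
    exact mul_pos hRpos (sub_pos.2 this)
  have hlo : (fun c => v c - β * R * v (R * (W - c))) x₂ ≤ 0 := by
    have e : R * (W - x₂) = y₂ := by rw [hx₂]; field_simp; ring
    have := hv.le_of_le (half_pos hWpos) (show W / 2 ≤ x₂ by linarith)
    simp only [e]
    linarith
  have hhi : 0 ≤ (fun c => v c - β * R * v (R * (W - c))) x₁ := by
    have h1 : v (R * (W - x₁)) ≤ v (R * (W / 2)) :=
      hv.le_of_le (by positivity) (mul_le_mul_of_nonneg_left (by linarith) hRpos.le)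
    have := mul_le_mul_of_nonneg_left h1 (mul_pos hβ hRpos).le
    simp only
    linarith
  obtain ⟨c₀, hc₀, h0⟩ := intermediate_value_Icc' hx₁₂ hcont ⟨hlo, hhi⟩
  have hcW : c₀ < W := by linarith [hc₀.2]
  refine ⟨c₀, R * (W - c₀), k, hx₁.trans_le hc₀.1, mul_pos hRpos (sub_pos.2 hcW), hk, hmp,
    sub_eq_zero.1 h0, ?_⟩
  rw [hRW]
  linarith

/-- For large returns the agent lends. -/
theorem exists_forall_lend (hv : IsMarginal v) (hF : IsTechnology F f) (ha : 0 < a) (hβ : 0 < β)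
    (he₀ : 0 < e₀) (he₁ : 0 ≤ e₁) :
    ∃ r, ∀ R, r ≤ R → ∀ c₀ c₁ k, IsDemand v F f β R a e₀ e₁ c₀ c₁ k → c₀ + k < e₀ := by
  set κ := e₀ / 2 with hκ
  have hκ0 : 0 < κ := half_pos he₀
  set M := a * F κ + e₁ + 1 with hM
  have hM0 : 0 < M := by have := mul_nonneg ha.le (hF.nonneg hκ0.le); linarith
  have hvM := hv.pos M hM0
  -- The first threshold forces `k ≤ κ`. A non-lender then has `c₀ ≥ κ` and `c₁ < M`, and the second
  -- threshold makes the Euler equation impossible.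
  refine ⟨max (a * f κ) (v κ / (β * v M)), fun R hR c₀ c₁ k h => ?_⟩
  have hRpos := h.R_pos hF ha
  have hk : k ≤ κ := by
    have := (le_max_left _ _).trans hR
    rw [← h.marginal_product] at this
    exact (hF.marginal.strictAntiOn.le_iff_ge hκ0 h.k_pos).1 (le_of_mul_le_mul_left this ha)
  by_contra! hb
  have h2 := (le_max_right _ _).trans hR
  rw [div_le_iff₀ (by positivity)] at h2
  have h3 : v c₀ ≤ v κ := hv.le_of_le hκ0 (by linarith)
  have hMlt : c₁ < M := by
    have h1 := mul_le_mul_of_nonneg_left (hF.strictMonoOn.monotoneOn h.k_pos.le hκ0.le hk) ha.le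
    have h2 : R * (e₀ - c₀ - k) ≤ 0 := mul_nonpos_of_nonneg_of_nonpos hRpos.le (by linarith)
    rw [h.budget]
    linarith
  have h4 := mul_lt_mul_of_pos_left (hv.lt_of_lt h.c₁_pos hMlt) (mul_pos hβ hRpos)
  rw [← h.euler] at h4
  linarith

/-- Demand depends continuously on the return, the productivity and the incomes. -/
theorem tendsto {α : Type*} {l : Filter α} (hv : IsMarginal v) (hF : IsTechnology F f)
    (hβ : 0 < β) {R a e₀ e₁ c₀ c₁ k : α → ℝ} {R' a' e₀' e₁' c₀' c₁' k' : ℝ}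
    (hRt : Tendsto R l (𝓝 R')) (hat : Tendsto a l (𝓝 a')) (he₀t : Tendsto e₀ l (𝓝 e₀'))
    (he₁t : Tendsto e₁ l (𝓝 e₁')) (ha' : 0 < a')
    (h : ∀ᶠ x in l, IsDemand v F f β (R x) (a x) (e₀ x) (e₁ x) (c₀ x) (c₁ x) (k x))
    (h' : IsDemand v F f β R' a' e₀' e₁' c₀' c₁' k') :
    Tendsto c₀ l (𝓝 c₀') ∧ Tendsto c₁ l (𝓝 c₁') ∧ Tendsto k l (𝓝 k') := by
  have hR' := h'.R_pos hF ha'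
  have hk : Tendsto k l (𝓝 k') := by
    refine hF.marginal.tendsto_of_tendsto_map (h.mono fun x hx => hx.k_pos) h'.k_pos ?_
    have e : f k' = R' / a' := by rw [← h'.marginal_product]; field_simp
    rw [e]
    refine (hRt.div hat ha'.ne').congr' ?_
    filter_upwards [h, hat.eventually_const_lt ha'] with x hx hax
    rw [Pi.div_apply, ← hx.marginal_product]; field_simp
  -- Fix `c` as date-0 consumption and let the budget determine date-1 consumption. The resulting
  -- Euler gap is continuous in the data and decreasing in `c`, so its sign at points on either side
  -- of `c₀'` confines `c₀ x`.
  have hFk : Tendsto (fun x => F (k x)) l (𝓝 (F k')) :=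
    (hF.continuousOn.continuousAt (Ici_mem_nhds h'.k_pos)).tendsto.comp hk
  have hG : ∀ c, Tendsto (fun x => R x * (e₀ x - c - k x) + a x * F (k x) + e₁ x) l
      (𝓝 (R' * (e₀' - c - k') + a' * F k' + e₁')) := fun c =>
    ((hRt.mul ((he₀t.sub_const c).sub hk)).add (hat.mul hFk)).add he₁t
  have hgap : ∀ c, 0 < R' * (e₀' - c - k') + a' * F k' + e₁' →
      Tendsto (fun x => v c - β * R x * v (R x * (e₀ x - c - k x) + a x * F (k x) + e₁ x)) l
        (𝓝 (v c - β * R' * v (R' * (e₀' - c - k') + a' * F k' + e₁'))) := fun c hc =>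
    ((hRt.const_mul β).mul ((hv.continuousAt hc).tendsto.comp (hG c))).const_sub _
  have hc₀ : Tendsto c₀ l (𝓝 c₀') := by
    refine tendsto_order.2 ⟨fun y hy => ?_, fun y hy => ?_⟩
    · rcases le_or_gt y 0 with hy0 | hy0
      · exact h.mono fun x hx => hy0.trans_lt hx.c₀_pos
      have hlt : c₁' < R' * (e₀' - y - k') + a' * F k' + e₁' := by
        have := mul_lt_mul_of_pos_left hy hR'
        rw [h'.budget]
        linarith
      have hpos := h'.c₁_pos.trans hlt
      have hg : 0 < v y - β * R' * v (R' * (e₀' - y - k') + a' * F k' + e₁') := by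
        have h1 := hv.lt_of_lt hy0 hy
        have h2 := mul_lt_mul_of_pos_left (hv.lt_of_lt h'.c₁_pos hlt) (mul_pos hβ hR')
        rw [← h'.euler] at h2
        linarith
      filter_upwards [h, (hgap y hpos).eventually_const_lt hg, (hG y).eventually_const_lt hpos,
        hRt.eventually_const_lt hR'] with x hx h1 h2 h3
      by_contra! hcy
      have h4 := hv.le_of_le hx.c₀_pos hcy
      have h5 : R x * (e₀ x - y - k x) + a x * F (k x) + e₁ x ≤ c₁ x := by
        have := mul_le_mul_of_nonneg_left hcy h3.le
        rw [hx.budget]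
        linarith
      have h6 := mul_le_mul_of_nonneg_left (hv.le_of_le h2 h5) (mul_pos hβ h3).le
      rw [← hx.euler] at h6
      linarith
    -- At `y` the budget may leave nothing for date 1. The point `z` exceeds `c₀'` by so little that
    -- at least half of `c₁'` remains.
    · obtain ⟨z, hcz, hzy, hzpos⟩ : ∃ z, c₀' < z ∧ z ≤ y ∧
          0 < R' * (e₀' - z - k') + a' * F k' + e₁' := by
        have hq : 0 < c₁' / (2 * R') := by have := h'.c₁_pos; positivity
        refine ⟨min y (c₀' + c₁' / (2 * R')), lt_min hy (by linarith), min_le_left _ _, ?_⟩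
        have h1 := mul_le_mul_of_nonneg_left (min_le_right y (c₀' + c₁' / (2 * R'))) hR'.le
        have h2 : R' * (c₀' + c₁' / (2 * R')) = R' * c₀' + c₁' / 2 := by field_simp
        have h3 := h'.budget
        have h4 := h'.c₁_pos
        linarith
      have hz0 := h'.c₀_pos.trans hcz
      have hlt : R' * (e₀' - z - k') + a' * F k' + e₁' < c₁' := by
        have := mul_lt_mul_of_pos_left hcz hR'
        rw [h'.budget]
        linarith
      have hg : v z - β * R' * v (R' * (e₀' - z - k') + a' * F k' + e₁') < 0 := by
        have h1 := hv.lt_of_lt h'.c₀_pos hcz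
        have h2 := mul_lt_mul_of_pos_left (hv.lt_of_lt hzpos hlt) (mul_pos hβ hR')
        rw [← h'.euler] at h2
        linarith
      filter_upwards [h, (hgap z hzpos).eventually_lt_const hg, hRt.eventually_const_lt hR']
        with x hx h1 h3
      refine lt_of_lt_of_le ?_ hzy
      by_contra! hcy
      have h4 := hv.le_of_le hz0 hcy
      have h5 : c₁ x ≤ R x * (e₀ x - z - k x) + a x * F (k x) + e₁ x := by
        have := mul_le_mul_of_nonneg_left hcy h3.le
        rw [hx.budget]
        linarith
      have h6 := mul_le_mul_of_nonneg_left (hv.le_of_le hx.c₁_pos h5) (mul_pos hβ h3).le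
      rw [← hx.euler] at h6
      linarith
  refine ⟨hc₀, ?_, hk⟩
  rw [h'.budget]
  refine (((hRt.mul ((he₀t.sub hc₀).sub hk)).add (hat.mul hFk)).add he₁t).congr' ?_
  exact h.mono fun x hx => hx.budget.symm

end IsDemand

/-! ### Concave functions and their derivatives -/

/-- The graph of a concave function lies below its tangents. -/
theorem ConcaveOn.le_tangent {S : Set ℝ} {g : ℝ → ℝ} (hg : ConcaveOn ℝ S g) {x y : ℝ}
    (hx : x ∈ S) (hy : y ∈ S) (hd : DifferentiableAt ℝ g x) :
    g y ≤ g x + deriv g x * (y - x) := by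
  rcases lt_trichotomy x y with h | rfl | h
  · have := hg.slope_le_deriv hx hy h hd
    rw [slope_def_field, div_le_iff₀ (sub_pos.2 h)] at this
    linarith
  · simp
  · have := hg.deriv_le_slope hy hx h hd
    rw [slope_def_field, le_div_iff₀ (sub_pos.2 h)] at this
    linarith

/-- The derivative of a strictly increasing, strictly concave `C¹` function on `(0, ∞)` satisfying
the Inada condition at `0`. -/
theorem isMarginal_deriv {g : ℝ → ℝ} (hd : ContDiffOn ℝ 1 g (Ioi 0))
    (hmono : StrictMonoOn g (Ioi 0)) (hconc : StrictConcaveOn ℝ (Ioi 0) g)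
    (hin : Tendsto (deriv g) (𝓝[>] 0) atTop) : IsMarginal (deriv g) := by
  have hdiff : ∀ x ∈ Ioi (0 : ℝ), DifferentiableAt ℝ g x := fun x hx =>
    (hd.differentiableOn one_ne_zero).differentiableAt (Ioi_mem_nhds hx)
  have hanti := hconc.strictAntiOn_deriv hdiff
  refine ⟨fun c hc => ?_, hd.continuousOn_deriv_of_isOpen isOpen_Ioi le_rfl, hanti, hin⟩
  -- The derivative at `c` exceeds the slope over `[c, c + 1]`, which is positive.
  have hc1 : c < c + 1 := by linarith
  have hc1' : c + 1 ∈ Ioi (0 : ℝ) := hc.trans hc1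
  have h1 := hconc.slope_lt_deriv hc hc1' hc1 (hdiff c hc)
  have h2 := hmono hc hc1' hc1
  rw [slope_def_field] at h1
  exact (div_pos (sub_pos.2 h2) (sub_pos.2 hc1)).trans h1

/-! ### The agent's problem and its first-order conditions -/

namespace Economy

variable {m : ℕ} {E : Economy m}

/-- Marginal utility of agent `i`. -/
noncomputable def margUtil (E : Economy m) (i : Fin m) : ℝ → ℝ := deriv (E.util i)

/-- After-tax productivity of agent `i`. -/
def prod (E : Economy m) (i : Fin m) (D₀ : ℝ) : ℝ := (1 - E.τ i 1) * E.A i D₀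

/-- Date-0 income of agent `i`. -/
def income₀ (E : Economy m) (i : Fin m) (T₀ : ℝ) : ℝ := (1 - E.τ i 0) * E.w i + E.γ i 0 * T₀

theorem prod_pos (hA : E.ProductivityAssumption) (hE : E.AgentAssumption) (i : Fin m) {D₀ : ℝ}
    (hD : 0 ≤ D₀) : 0 < E.prod i D₀ :=
  mul_pos (sub_pos.2 (hE.τ_mem i 1).2)
    ((hA.pos_zero i).trans_le (hA.monotoneOn i self_mem_Ici hD hD))

theorem income₀_pos (hE : E.AgentAssumption) (i : Fin m) {T₀ : ℝ} (hT : 0 ≤ T₀) :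
    0 < E.income₀ i T₀ :=
  add_pos_of_pos_of_nonneg (mul_pos (sub_pos.2 (hE.τ_mem i 0).2) (hE.w_pos i))
    (mul_nonneg (hE.γ_mem i 0).1 hT)

theorem income₁_nonneg (hE : E.AgentAssumption) (i : Fin m) {T₁ : ℝ} (hT : 0 ≤ T₁) :
    0 ≤ E.γ i 1 * T₁ :=
  mul_nonneg (hE.γ_mem i 1).1 hT

theorem coe_util (hE : E.AgentAssumption) (i : Fin m) {c : ℝ} (hc : 0 < c) :
    ((E.util i c : ℝ) : EReal) = E.u i c :=
  EReal.coe_toReal (hE.u_finite i c hc).2 (hE.u_finite i c hc).1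

/-- Finiteness is assumed only on `(0, ∞)`; at `0` the value `⊤` is excluded because a larger value
is attained to the right. -/
theorem u_ne_top (hE : E.AgentAssumption) (i : Fin m) {c : ℝ} (hc : 0 ≤ c) : E.u i c ≠ ⊤ :=
  ne_top_of_lt (hE.u_strictMonoOn i hc (by positivity : (0 : ℝ) ≤ c + 1) (by linarith))

theorem coe_util_of_ne_bot (hE : E.AgentAssumption) (i : Fin m) {c : ℝ} (hc : 0 ≤ c)
    (h : E.u i c ≠ ⊥) : ((E.util i c : ℝ) : EReal) = E.u i c :=
  EReal.coe_toReal (u_ne_top hE i hc) h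

theorem util_lt (hE : E.AgentAssumption) (i : Fin m) {c d : ℝ} (hc : 0 ≤ c) (h : E.u i c ≠ ⊥)
    (hcd : c < d) : E.util i c < E.util i d := by
  rw [← EReal.coe_lt_coe_iff, coe_util_of_ne_bot hE i hc h, coe_util hE i (hc.trans_lt hcd)]
  exact hE.u_strictMonoOn i hc (hc.trans hcd.le) hcd

theorem differentiableAt_util (hE : E.AgentAssumption) (i : Fin m) {c : ℝ} (hc : 0 < c) :
    DifferentiableAt ℝ (E.util i) c :=
  ((hE.u_contDiffOn i).differentiableOn two_ne_zero).differentiableAt (Ioi_mem_nhds hc)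

theorem differentiableAt_F (hE : E.AgentAssumption) (i : Fin m) {k : ℝ} (hk : 0 < k) :
    DifferentiableAt ℝ (E.F i) k :=
  ((hE.F_contDiffOn i).differentiableOn one_ne_zero).differentiableAt (Ioi_mem_nhds hk)

theorem isMarginal_margUtil (hE : E.AgentAssumption) (i : Fin m) : IsMarginal (E.margUtil i) :=
  isMarginal_deriv ((hE.u_contDiffOn i).of_le one_le_two)
    (fun _ hc _ _ hcd => util_lt hE i (le_of_lt hc) (hE.u_finite i _ hc).1 hcd)
    (hE.u_strictConcaveOn i) (hE.u_inada i)

/-- The derivative of `c * u'(c)` is `u'(c) + c * u''(c)`, the quantity in the elasticity condition.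
-/
theorem monotoneOn_mul_margUtil (hE : E.AgentAssumption) (hF : E.AdditionalAssumption)
    (i : Fin m) : MonotoneOn (fun c => c * E.margUtil i c) (Ioi 0) := by
  have hd : DifferentiableOn ℝ (deriv (E.util i)) (Ioi 0) :=
    (((contDiffOn_succ_iff_deriv_of_isOpen (n := 1) isOpen_Ioi).1
      (hE.u_contDiffOn i)).2.2).differentiableOn one_ne_zero
  have hd' : ∀ c ∈ Ioi (0 : ℝ), HasDerivAt (fun c => c * E.margUtil i c)
      (1 * deriv (E.util i) c + c * deriv (deriv (E.util i)) c) c := fun c hc =>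
    (hasDerivAt_id c).mul (hd.differentiableAt (Ioi_mem_nhds hc)).hasDerivAt
  refine monotoneOn_of_deriv_nonneg (convex_Ioi 0)
    (fun c hc => (hd' c hc).continuousAt.continuousWithinAt) ?_ ?_
  · rw [interior_Ioi]
    exact fun c hc => (hd' c hc).differentiableAt.differentiableWithinAt
  · rw [interior_Ioi]
    intro c hc
    rw [(hd' c hc).deriv, one_mul]
    exact hF.u_elasticity i c hc

theorem isTechnology_F (hE : E.AgentAssumption) (hF : E.AdditionalAssumption) (i : Fin m) :
    IsTechnology (E.F i) (deriv (E.F i)) where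
  marginal := isMarginal_deriv (hE.F_contDiffOn i)
    ((hE.F_strictMonoOn i).mono Ioi_subset_Ici_self)
    ((hF.F_strictConcaveOn i).subset Ioi_subset_Ici_self (convex_Ioi 0)) (hF.F_inada i)
  continuousOn := hE.F_continuousOn i
  strictMonoOn := hE.F_strictMonoOn i
  map_zero := hE.F_zero i
  le_tangent _ _ hx hy := (hE.F_concaveOn i).le_tangent hx.le hy (differentiableAt_F hE i hx)

/-- The tangent inequality for utility, including the boundary point `0`. -/
theorem util_le_tangent (hE : E.AgentAssumption) (i : Fin m) {c d : ℝ} (hc : 0 < c) (hd : 0 ≤ d)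
    (h : E.u i d ≠ ⊥) : E.util i d ≤ E.util i c + E.margUtil i c * (d - c) := by
  have key : ∀ x, 0 < x → E.util i x ≤ E.util i c + E.margUtil i c * (x - c) := fun x hx =>
    (hE.u_strictConcaveOn i).concaveOn.le_tangent hc hx (differentiableAt_util hE i hc)
  have hlim : Tendsto (fun x => E.util i c + E.margUtil i c * (x - c)) (𝓝[>] d)
      (𝓝 (E.util i c + E.margUtil i c * (d - c))) :=
    (Continuous.tendsto (by fun_prop) d).mono_left nhdsWithin_le_nhds
  -- Monotonicity bounds utility at `d` by its values to the right, where the tangent inequality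
  -- holds; only the tangent line needs to pass to the limit.
  refine ge_of_tendsto hlim ?_
  filter_upwards [self_mem_nhdsWithin] with x hx
  exact (util_lt hE i hd h hx).le.trans (key x (hd.trans_lt hx))

theorem objective_eq_coe (hE : E.AgentAssumption) (i : Fin m) {c d : ℝ} (hc : 0 ≤ c) (hd : 0 ≤ d)
    (h : E.u i c ≠ ⊥) (h' : E.u i d ≠ ⊥) :
    E.objective i c d = ((E.util i c + E.β i * E.util i d : ℝ) : EReal) := by
  rw [objective, EReal.coe_add, EReal.coe_mul, coe_util_of_ne_bot hE i hc h,
    coe_util_of_ne_bot hE i hd h']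

theorem ne_bot_of_objective_ne_bot (hE : E.AgentAssumption) (i : Fin m) {c d : ℝ}
    (h : E.objective i c d ≠ ⊥) : E.u i c ≠ ⊥ ∧ E.u i d ≠ ⊥ := by
  refine ⟨fun hc => h ?_, fun hd => h ?_⟩
  · rw [objective, hc, EReal.bot_add]
  · rw [objective, hd, EReal.coe_mul_bot_of_pos (hE.β_mem i).1, EReal.add_bot]

variable {i : Fin m} {T₀ T₁ D₀ R c₀ c₁ k b : ℝ}

/-- The first-order conditions are sufficient. -/
theorem solvesAgent_of_isDemand (hA : E.ProductivityAssumption) (hE : E.AgentAssumption)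
    (hF : E.AdditionalAssumption) (hD : 0 ≤ D₀)
    (h : IsDemand (E.margUtil i) (E.F i) (deriv (E.F i)) (E.β i) R (E.prod i D₀)
      (E.income₀ i T₀) (E.γ i 1 * T₁) c₀ c₁ k)
    (hb : b = c₀ + k - E.income₀ i T₀) : E.SolvesAgent i T₀ T₁ D₀ R c₀ c₁ k b := by
  have ha := prod_pos hA hE i hD
  have hT := isTechnology_F hE hF i
  have hRpos := h.R_pos hT ha
  refine ⟨⟨?_, ?_, h.c₀_pos.le, h.c₁_pos.le, h.k_pos.le⟩, ?_⟩
  · rw [hb, income₀]; linarith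
  · rw [h.budget, hb]
    change _ ≤ E.prod i D₀ * _ - _ + _
    linarith
  rintro x₀ x₁ k' b' ⟨h0, h1, hx₀, hx₁, hk'⟩
  by_cases hbot : E.objective i x₀ x₁ = ⊥
  · rw [hbot]; exact bot_le
  obtain ⟨hu₀, hu₁⟩ := ne_bot_of_objective_ne_bot hE i hbot
  rw [objective_eq_coe hE i hx₀ hx₁ hu₀ hu₁, objective_eq_coe hE i h.c₀_pos.le h.c₁_pos.le
    (hE.u_finite i _ h.c₀_pos).1 (hE.u_finite i _ h.c₁_pos).1, EReal.coe_le_coe_iff]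
  have t₀ := util_le_tangent hE i h.c₀_pos hx₀ hu₀
  have t₁ := mul_le_mul_of_nonneg_left (util_le_tangent hE i h.c₁_pos hx₁ hu₁) (hE.β_mem i).1.le
  rw [h.euler] at t₀
  have hprofit := hT.profit_le ha h.k_pos h.marginal_product hk'
  have hbud : R * (x₀ - c₀) + (x₁ - c₁) ≤ 0 := by
    have e0 : x₀ + k' - E.income₀ i T₀ ≤ b' := by rw [income₀]; linarith
    have := mul_le_mul_of_nonneg_left e0 hRpos.le
    change x₁ ≤ E.prod i D₀ * E.F i k' - R * b' + E.γ i 1 * T₁ at h1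
    rw [h.budget]
    linarith
  -- By the Euler equation the two tangent inequalities add up to a utility gain of at most `β * v
  -- c₁` times the left side of `hbud`.
  have hpos := mul_pos (hE.β_mem i).1 ((isMarginal_margUtil hE i).pos c₁ h.c₁_pos)
  have := mul_nonpos_of_nonneg_of_nonpos hpos.le hbud
  linarith

/-- The first-order conditions are necessary, and the budget constraints bind. -/
theorem isDemand_of_solvesAgent (hA : E.ProductivityAssumption) (hE : E.AgentAssumption)
    (hF : E.AdditionalAssumption) (hT₀ : 0 ≤ T₀) (hT₁ : 0 ≤ T₁) (hD : 0 ≤ D₀) (hR : 0 < R)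
    (h : E.SolvesAgent i T₀ T₁ D₀ R c₀ c₁ k b) :
    IsDemand (E.margUtil i) (E.F i) (deriv (E.F i)) (E.β i) R (E.prod i D₀)
      (E.income₀ i T₀) (E.γ i 1 * T₁) c₀ c₁ k ∧ b = c₀ + k - E.income₀ i T₀ := by
  have ha := prod_pos hA hE i hD
  have he₀ := income₀_pos hE i hT₀
  have he₁ := income₁_nonneg hE i hT₁
  have hβ := (hE.β_mem i).1
  have hT := isTechnology_F hE hF i
  have hv := isMarginal_margUtil hE i
  obtain ⟨⟨hb₀, hb₁, hc₀, hc₁, hk⟩, hmax⟩ := h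
  change c₁ ≤ E.prod i D₀ * E.F i k - R * b + E.γ i 1 * T₁ at hb₁
  replace hb₀ : c₀ + k - E.income₀ i T₀ ≤ b := by rw [income₀]; linarith
  -- eliminating borrowing, feasibility is a single budget inequality
  have hfeas : ∀ x₀ x₁ l, 0 ≤ x₀ → 0 ≤ x₁ → 0 ≤ l →
      x₁ ≤ R * (E.income₀ i T₀ - x₀ - l) + E.prod i D₀ * E.F i l + E.γ i 1 * T₁ →
      E.objective i x₀ x₁ ≤ E.objective i c₀ c₁ := fun x₀ x₁ l hx₀ hx₁ hl hx =>
    hmax x₀ x₁ l (x₀ + l - E.income₀ i T₀) ⟨by rw [income₀]; linarith, by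
      change x₁ ≤ E.prod i D₀ * E.F i l - _ + _
      linarith, hx₀, hx₁, hl⟩
  have hbud : c₁ ≤ R * (E.income₀ i T₀ - c₀ - k) + E.prod i D₀ * E.F i k + E.γ i 1 * T₁ := by
    have := mul_le_mul_of_nonneg_left hb₀ hR.le
    linarith
  -- Consuming half the date-0 income and lending the rest gives finite utility, so the optimum is
  -- not `⊥`.
  obtain ⟨y₀, y₁, hy₀, hy₁, hy⟩ : ∃ y₀ y₁, 0 < y₀ ∧ 0 < y₁ ∧
      E.objective i y₀ y₁ ≤ E.objective i c₀ c₁ := by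
    have h2 := half_pos he₀
    refine ⟨E.income₀ i T₀ / 2, R * (E.income₀ i T₀ / 2), h2, mul_pos hR h2,
      hfeas _ _ 0 h2.le (mul_pos hR h2).le le_rfl ?_⟩
    rw [hE.F_zero i]
    linarith
  rw [objective_eq_coe hE i hy₀.le hy₁.le (hE.u_finite i _ hy₀).1 (hE.u_finite i _ hy₁).1] at hy
  have hnb : E.objective i c₀ c₁ ≠ ⊥ := ((EReal.bot_lt_coe _).trans_le hy).ne'
  obtain ⟨hu₀, hu₁⟩ := ne_bot_of_objective_ne_bot hE i hnb
  have hobj := objective_eq_coe hE i hc₀ hc₁ hu₀ hu₁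
  rw [hobj, EReal.coe_le_coe_iff] at hy
  have hreal : ∀ x₀ x₁ l, 0 ≤ x₀ → 0 ≤ x₁ → E.u i x₀ ≠ ⊥ → E.u i x₁ ≠ ⊥ → 0 ≤ l →
      x₁ ≤ R * (E.income₀ i T₀ - x₀ - l) + E.prod i D₀ * E.F i l + E.γ i 1 * T₁ →
      E.util i x₀ + E.β i * E.util i x₁ ≤ E.util i c₀ + E.β i * E.util i c₁ := by
    intro x₀ x₁ l hx₀ hx₁ hux₀ hux₁ hl hx
    have := hfeas x₀ x₁ l hx₀ hx₁ hl hx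
    rwa [hobj, objective_eq_coe hE i hx₀ hx₁ hux₀ hux₁, EReal.coe_le_coe_iff] at this
  -- no plan leaves resources at date 1
  have hbest : ∀ l, 0 ≤ l →
      R * (E.income₀ i T₀ - c₀ - l) + E.prod i D₀ * E.F i l + E.γ i 1 * T₁ ≤ c₁ := by
    intro l hl
    by_contra! hlt
    have h1 := hreal c₀ _ l hc₀ (hc₁.trans hlt.le) hu₀
      (hE.u_finite i _ (hc₁.trans_lt hlt)).1 hl le_rfl
    have h2 := mul_lt_mul_of_pos_left (util_lt hE i hc₁ hu₁ hlt) hβ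
    linarith
  have hbudget := hbud.antisymm (hbest k hk)
  have hb : b = c₀ + k - E.income₀ i T₀ := by
    refine le_antisymm ?_ hb₀
    refine le_of_mul_le_mul_left ?_ hR
    linarith
  have hkpos : 0 < k := by
    refine hk.lt_of_ne fun h0 => ?_
    -- Investing `ε` with marginal product above `R` would pay: by concavity its output is at least
    -- `ε` times that marginal product, more than the forgone `R * ε`.
    obtain ⟨ε, hε, -, hεf⟩ := hT.marginal.exists_lt (R / E.prod i D₀) one_pos
    rw [div_lt_iff₀' ha] at hεf
    have h1 := hbest ε hε.le
    rw [hbudget, ← h0, hE.F_zero i] at h1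
    have h2 := hT.le_tangent ε 0 hε le_rfl
    rw [hE.F_zero i] at h2
    have h3 := mul_le_mul_of_nonneg_left h2 ha.le
    have h4 := mul_lt_mul_of_pos_left hεf hε
    linarith
  -- transfers along the budget line
  have hmove : ∀ ε, 0 ≤ c₀ + ε → 0 ≤ c₁ - R * ε → E.u i (c₀ + ε) ≠ ⊥ →
      E.u i (c₁ - R * ε) ≠ ⊥ → E.util i (c₀ + ε) + E.β i * E.util i (c₁ - R * ε) ≤
        E.util i c₀ + E.β i * E.util i c₁ := fun ε h0 h1 h0' h1' =>
    hreal _ _ k h0 h1 h0' h1' hk (by linarith)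
  have hor : 0 < c₀ ∨ 0 < c₁ := by
    by_contra! hcc
    obtain rfl : c₀ = 0 := le_antisymm hcc.1 hc₀
    obtain rfl : c₁ = 0 := le_antisymm hcc.2 hc₁
    have h1 := util_lt hE i le_rfl hu₀ hy₀
    have h2 := mul_lt_mul_of_pos_left (util_lt hE i le_rfl hu₁ hy₁) hβ
    linarith
  have hc₀pos : 0 < c₀ := by
    refine hc₀.lt_of_ne' fun h0 => ?_
    subst h0
    have hc₁pos : 0 < c₁ := hor.resolve_left (lt_irrefl _)
    -- Moving `ε` to date 0 gains at least `ε * v ε`. It leaves more than half of `c₁`, so it costs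
    -- at most `β * R * ε * v (c₁ / 2)`, which is smaller.
    obtain ⟨ε, hε, hε1, hεv⟩ := hv.exists_lt (E.β i * R * E.margUtil i (c₁ / 2))
      (show 0 < c₁ / (2 * R) by positivity)
    rw [lt_div_iff₀ (by positivity)] at hε1
    have hx : c₁ / 2 ≤ c₁ - R * ε := by linarith
    have hx0 : 0 < c₁ - R * ε := (half_pos hc₁pos).trans_le hx
    have h1 := hmove ε (by linarith) hx0.le (by rw [zero_add]; exact (hE.u_finite i _ hε).1)
      (hE.u_finite i _ hx0).1
    rw [zero_add] at h1
    have h2 := util_le_tangent hE i hε le_rfl hu₀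
    have h3 := mul_le_mul_of_nonneg_left (util_le_tangent hE i hx0 hc₁ hu₁) hβ.le
    have h4 := mul_le_mul_of_nonneg_left (hv.le_of_le (half_pos hc₁pos) hx)
      (mul_pos (mul_pos hβ hR) hε).le
    have h5 := mul_lt_mul_of_pos_left hεv hε
    linarith
  have hc₁pos : 0 < c₁ := by
    refine hc₁.lt_of_ne' fun h0 => ?_
    subst h0
    -- The mirror transfer: giving up `ε / R` at date 0, less than half of `c₀`, buys `ε` at date 1.
    obtain ⟨ε, hε, hε1, hεv⟩ := hv.exists_lt (E.margUtil i (c₀ / 2) / (E.β i * R))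
      (show 0 < R * (c₀ / 2) by positivity)
    rw [div_lt_iff₀' (by positivity)] at hεv
    have hεR : ε / R < c₀ / 2 := by rwa [div_lt_iff₀' hR]
    have hx : c₀ / 2 ≤ c₀ + -(ε / R) := by linarith
    have hx0 : 0 < c₀ + -(ε / R) := (half_pos hc₀pos).trans_le hx
    have e : (0 : ℝ) - R * -(ε / R) = ε := by field_simp; ring
    have h1 := hmove (-(ε / R)) hx0.le (by rw [e]; exact hε.le) (hE.u_finite i _ hx0).1
      (by rw [e]; exact (hE.u_finite i _ hε).1)
    rw [e] at h1
    have h2 := mul_le_mul_of_nonneg_left (util_le_tangent hE i hε le_rfl hu₁) hβ.le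
    have h3 := util_le_tangent hE i hx0 hc₀ hu₀
    have h4 := mul_le_mul_of_nonneg_right (hv.le_of_le (half_pos hc₀pos) hx)
      (div_pos hε hR).le
    have h5 := mul_lt_mul_of_pos_right hεv (div_pos hε hR)
    have e2 : E.β i * R * E.margUtil i ε * (ε / R) = E.β i * (E.margUtil i ε * ε) := by field_simp
    linarith
  refine ⟨⟨hc₀pos, hc₁pos, hkpos, ?_, ?_, hbudget⟩, hb⟩
  · have hd : HasDerivAt (fun l => E.prod i D₀ * E.F i l - R * l)
        (E.prod i D₀ * deriv (E.F i) k - R * 1) k :=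
      ((differentiableAt_F hE i hkpos).hasDerivAt.const_mul _).sub
        ((hasDerivAt_id k).const_mul R)
    have hloc : IsLocalMax (fun l => E.prod i D₀ * E.F i l - R * l) k := by
      filter_upwards [Ioi_mem_nhds hkpos] with l hl
      have := hbest l (le_of_lt hl)
      linarith
    have := hloc.hasDerivAt_eq_zero hd
    linarith
  · have d0 : HasDerivAt (fun ε : ℝ => E.util i (c₀ + ε)) (E.margUtil i c₀) 0 := by
      refine HasDerivAt.comp_const_add c₀ 0 ?_
      rw [add_zero]
      exact (differentiableAt_util hE i hc₀pos).hasDerivAt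
    have d1 : HasDerivAt (fun ε : ℝ => E.util i (c₁ - R * ε)) (E.margUtil i c₁ * -(R * 1)) 0 := by
      have hin : HasDerivAt (fun ε : ℝ => c₁ - R * ε) (-(R * 1)) 0 :=
        ((hasDerivAt_id (0 : ℝ)).const_mul R).const_sub c₁
      refine HasDerivAt.comp (h₂ := E.util i) 0 ?_ hin
      rw [mul_zero, sub_zero]
      exact (differentiableAt_util hE i hc₁pos).hasDerivAt
    have hloc : IsLocalMax
        (fun ε : ℝ => E.util i (c₀ + ε) + E.β i * E.util i (c₁ - R * ε)) 0 := by
      have n0 : ∀ᶠ ε : ℝ in 𝓝 0, 0 < c₀ + ε :=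
        (Continuous.tendsto' (by fun_prop) 0 c₀ (by ring)).eventually_const_lt hc₀pos
      have n1 : ∀ᶠ ε : ℝ in 𝓝 0, 0 < c₁ - R * ε :=
        (Continuous.tendsto' (by fun_prop) 0 c₁ (by ring)).eventually_const_lt hc₁pos
      filter_upwards [n0, n1] with ε h0 h1
      simpa using hmove ε h0.le h1.le (hE.u_finite i _ h0).1 (hE.u_finite i _ h1).1
    have := hloc.hasDerivAt_eq_zero (d0.add (d1.const_mul _))
    linarith

end Economy

/-! ### Market clearing and aggregate demand -/

namespace Economy

variable {m : ℕ} {E : Economy m}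

/-- Demand of agent `i` at the return `R`, given the policy `p = (T₀, T₁, D₀)`. -/
def AgentDemand (E : Economy m) (i : Fin m) (p : ℝ × ℝ × ℝ) (R c₀ c₁ k : ℝ) : Prop :=
  IsDemand (E.margUtil i) (E.F i) (deriv (E.F i)) (E.β i) R (E.prod i p.2.2)
    (E.income₀ i p.1) (E.γ i 1 * p.2.1) c₀ c₁ k

theorem sum_income₀ (E : Economy m) (T₀ : ℝ) :
    ∑ i, E.income₀ i T₀ = (∑ i, (1 - E.τ i 0) * E.w i) + (∑ i, E.γ i 0) * T₀ := by
  simp only [income₀, Finset.sum_add_distrib, Finset.sum_mul]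

/-- Equilibria are the solutions of the first-order conditions which clear the date-0 market. -/
theorem isCompetitiveEquilibrium_iff (hm : 0 < m) (hA : E.ProductivityAssumption)
    (hE : E.AgentAssumption) (hF : E.AdditionalAssumption) {p : ℝ × ℝ × ℝ}
    (hp : p ∈ admissiblePolicies) {x : Outcome m} :
    E.IsCompetitiveEquilibrium p.1 p.2.1 p.2.2 x ↔
      (∀ i, E.AgentDemand i p x.R (x.c₀ i) (x.c₁ i) (x.k i)) ∧
      (∀ i, x.b i = x.c₀ i + x.k i - E.income₀ i p.1) ∧
      ∑ i, (x.c₀ i + x.k i) = ∑ i, E.income₀ i p.1 := by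
  obtain ⟨hT₀, hT₁, hD, -⟩ := hp
  constructor
  · intro h
    have key := fun i => isDemand_of_solvesAgent hA hE hF hT₀ hT₁ hD h.R_pos (h.solves i)
    exact ⟨fun i => (key i).1, fun i => (key i).2, by rw [sum_income₀]; exact h.good₀⟩
  · rintro ⟨hd, hb, hs⟩
    have hbonds : ∑ i, x.b i = 0 := by
      simp only [hb, Finset.sum_sub_distrib]
      rw [hs, sub_self]
    refine ⟨(hd ⟨0, hm⟩).R_pos (isTechnology_F hE hF _) (prod_pos hA hE _ hD),
      fun i => solvesAgent_of_isDemand hA hE hF hD (hd i) (hb i), by rw [hs, sum_income₀], ?_,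
      hbonds⟩
    -- Walras' law: summing the date-1 budgets, the debt terms cancel.
    have hc₁ : ∀ i, x.c₁ i =
        (1 - E.τ i 1) * E.A i p.2.2 * E.F i (x.k i) + E.γ i 1 * p.2.1 - x.R * x.b i := by
      intro i
      rw [(hd i).budget, hb i, prod]
      ring
    rw [Finset.sum_congr rfl fun i _ => hc₁ i, Finset.sum_sub_distrib, Finset.sum_add_distrib,
      ← Finset.mul_sum, hbonds, Finset.sum_mul]
    ring

section Demand

variable (hA : E.ProductivityAssumption) (hE : E.AgentAssumption) (hF : E.AdditionalAssumption)
  {i : Fin m} {p : ℝ × ℝ × ℝ}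

include hA hE hF

namespace AgentDemand

/-- Strictness comes from investment alone; consumption is only weakly decreasing. -/
theorem total_lt (hp : p ∈ admissiblePolicies) {R R' c₀ c₁ k c₀' c₁' k' : ℝ}
    (h : E.AgentDemand i p R c₀ c₁ k) (h' : E.AgentDemand i p R' c₀' c₁' k') (hR : R < R') :
    c₀' + k' < c₀ + k :=
  add_lt_add_of_le_of_lt
    (IsDemand.c₀_le (isMarginal_margUtil hE i) (monotoneOn_mul_margUtil hE hF i)
      (isTechnology_F hE hF i) (prod_pos hA hE i hp.2.2.1) (hE.β_mem i).1
      (income₁_nonneg hE i hp.2.1) h h' hR.le)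
    (IsDemand.k_lt (isTechnology_F hE hF i) (prod_pos hA hE i hp.2.2.1) h h' hR)

theorem unique (hp : p ∈ admissiblePolicies) {R c₀ c₁ k c₀' c₁' k' : ℝ}
    (h : E.AgentDemand i p R c₀ c₁ k) (h' : E.AgentDemand i p R c₀' c₁' k') :
    c₀ = c₀' ∧ c₁ = c₁' ∧ k = k' :=
  IsDemand.unique (isMarginal_margUtil hE i) (monotoneOn_mul_margUtil hE hF i)
    (isTechnology_F hE hF i) (prod_pos hA hE i hp.2.2.1) (hE.β_mem i).1
    (income₁_nonneg hE i hp.2.1) h h'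

theorem exists_of_le (hp : p ∈ admissiblePolicies) {R x : ℝ} (hx : 0 < x)
    (hR : E.prod i p.2.2 * deriv (E.F i) x ≤ R) : ∃ c₀ c₁ k, E.AgentDemand i p R c₀ c₁ k :=
  IsDemand.exists_of_le (isMarginal_margUtil hE i) (isTechnology_F hE hF i)
    (prod_pos hA hE i hp.2.2.1) (hE.β_mem i).1 (income₀_pos hE i hp.1)
    (income₁_nonneg hE i hp.2.1) hx hR

theorem exists_forall_lend (i : Fin m) (hp : p ∈ admissiblePolicies) :
    ∃ r, ∀ R, r ≤ R → ∀ c₀ c₁ k, E.AgentDemand i p R c₀ c₁ k → c₀ + k < E.income₀ i p.1 :=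
  IsDemand.exists_forall_lend (isMarginal_margUtil hE i) (isTechnology_F hE hF i)
    (prod_pos hA hE i hp.2.2.1) (hE.β_mem i).1 (income₀_pos hE i hp.1)
    (income₁_nonneg hE i hp.2.1)

end AgentDemand

omit hE hF in
theorem tendsto_prod (i : Fin m) {α : Type*} {l : Filter α} {q : α → ℝ × ℝ × ℝ}
    (hp : p ∈ admissiblePolicies) (hq : ∀ᶠ x in l, q x ∈ admissiblePolicies)
    (hqt : Tendsto q l (𝓝 p)) :
    Tendsto (fun x => E.prod i (q x).2.2) l (𝓝 (E.prod i p.2.2)) := by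
  refine Tendsto.const_mul _ ((hA.continuousOn i p.2.2 hp.2.2.1).tendsto.comp ?_)
  exact tendsto_nhdsWithin_iff.2 ⟨(continuous_snd.comp continuous_snd).continuousAt.tendsto.comp hqt,
    hq.mono fun x hx => hx.2.2.1⟩

theorem AgentDemand.tendsto {α : Type*} {l : Filter α} {q : α → ℝ × ℝ × ℝ}
    (hp : p ∈ admissiblePolicies) (hq : ∀ᶠ x in l, q x ∈ admissiblePolicies)
    (hqt : Tendsto q l (𝓝 p)) {R c₀ c₁ k : α → ℝ} {R' c₀' c₁' k' : ℝ}
    (hR : Tendsto R l (𝓝 R'))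
    (h : ∀ᶠ x in l, E.AgentDemand i (q x) (R x) (c₀ x) (c₁ x) (k x))
    (h' : E.AgentDemand i p R' c₀' c₁' k') :
    Tendsto c₀ l (𝓝 c₀') ∧ Tendsto c₁ l (𝓝 c₁') ∧ Tendsto k l (𝓝 k') := by
  refine IsDemand.tendsto (isMarginal_margUtil hE i) (isTechnology_F hE hF i) (hE.β_mem i).1 hR
    (tendsto_prod hA i hp hq hqt) ?_ ?_ (prod_pos hA hE i hp.2.2.1) h h'
  · exact ((continuous_fst.continuousAt.tendsto.comp hqt).const_mul _).const_add _
  · exact ((continuous_fst.comp continuous_snd).continuousAt.tendsto.comp hqt).const_mul _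

/-! ### Existence and uniqueness of equilibrium -/

/-- An equilibrium exists. -/
theorem exists_isCompetitiveEquilibrium (hm : 0 < m) (hp : p ∈ admissiblePolicies) :
    ∃ x : Outcome m, E.IsCompetitiveEquilibrium p.1 p.2.1 p.2.2 x := by
  have : Nonempty (Fin m) := ⟨⟨0, hm⟩⟩
  set K := ∑ i, E.income₀ i p.1 with hK
  have hKpos : 0 < K :=
    Finset.sum_pos (fun i _ => income₀_pos hE i hp.1) Finset.univ_nonempty
  -- With `r` the largest marginal product at `K`, every agent has a demand at each `R ≥ r`. At `R =
  -- r` agent `j` invests exactly `K`, so spending exceeds aggregate income.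
  obtain ⟨j, hj⟩ := Finite.exists_max fun i => E.prod i p.2.2 * deriv (E.F i) K
  set r := E.prod j p.2.2 * deriv (E.F j) K with hr
  have hex : ∀ R, ∃ y : Fin m → ℝ × ℝ × ℝ, r ≤ R →
      ∀ i, E.AgentDemand i p R (y i).1 (y i).2.1 (y i).2.2 := by
    intro R
    by_cases hR : r ≤ R
    · choose c₀ c₁ k h using fun i => AgentDemand.exists_of_le hA hE hF hp hKpos ((hj i).trans hR)
      exact ⟨fun i => (c₀ i, c₁ i, k i), fun _ => h⟩
    · exact ⟨0, fun h => absurd h hR⟩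
  choose y hy using hex
  choose s hs using fun i => AgentDemand.exists_forall_lend hA hE hF i hp
  obtain ⟨j', hj'⟩ := Finite.exists_max s
  set S := max r (s j') with hS
  have hcont : ContinuousOn (fun R => ∑ i, ((y R i).1 + (y R i).2.2)) (Icc r S) := by
    intro R hR
    refine tendsto_finsetSum _ fun i _ => ?_
    have := AgentDemand.tendsto hA hE hF (i := i) (l := 𝓝[Icc r S] R) (q := fun _ => p) hp
      (Eventually.of_forall fun _ => hp) tendsto_const_nhds
      (tendsto_id.mono_left nhdsWithin_le_nhds)
      (eventually_mem_nhdsWithin.mono fun R' hR' => hy R' hR'.1 i) (hy R hR.1 i)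
    exact this.1.add this.2.2
  have hhi : K ≤ ∑ i, ((y r i).1 + (y r i).2.2) := by
    have hd := hy r le_rfl
    have hkj : (y r j).2.2 = K := by
      have h1 := (hd j).marginal_product
      exact (isTechnology_F hE hF j).marginal.strictAntiOn.injOn (hd j).k_pos hKpos
        (mul_left_cancel₀ (prod_pos hA hE j hp.2.2.1).ne' h1)
    have h2 := Finset.single_le_sum (f := fun i => (y r i).1 + (y r i).2.2)
      (fun i _ => (add_pos (hd i).c₀_pos (hd i).k_pos).le) (Finset.mem_univ j)
    have h3 := (hd j).c₀_pos
    linarith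
  have hlo : ∑ i, ((y S i).1 + (y S i).2.2) ≤ K :=
    Finset.sum_le_sum fun i _ =>
      (hs i S ((hj' i).trans (le_max_right _ _)) _ _ _ (hy S (le_max_left _ _) i)).le
  obtain ⟨R, hR, hRK⟩ := intermediate_value_Icc' (le_max_left r (s j')) hcont ⟨hlo, hhi⟩
  refine ⟨⟨fun i => (y R i).1, fun i => (y R i).2.1, fun i => (y R i).2.2,
    fun i => (y R i).1 + (y R i).2.2 - E.income₀ i p.1, R⟩, ?_⟩
  rw [isCompetitiveEquilibrium_iff hm hA hE hF hp]
  exact ⟨hy R hR.1, fun i => rfl, hRK⟩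

/-- There is at most one equilibrium. -/
theorem isCompetitiveEquilibrium_unique (hm : 0 < m) (hp : p ∈ admissiblePolicies)
    {x y : Outcome m} (hx : E.IsCompetitiveEquilibrium p.1 p.2.1 p.2.2 x)
    (hy : E.IsCompetitiveEquilibrium p.1 p.2.1 p.2.2 y) : x = y := by
  have : Nonempty (Fin m) := ⟨⟨0, hm⟩⟩
  obtain ⟨hxd, hxb, hxs⟩ := (isCompetitiveEquilibrium_iff hm hA hE hF hp).1 hx
  obtain ⟨hyd, hyb, hys⟩ := (isCompetitiveEquilibrium_iff hm hA hE hF hp).1 hy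
  have hR : x.R = y.R := by
    rcases lt_trichotomy x.R y.R with h | h | h
    · have := Finset.sum_lt_sum_of_nonempty Finset.univ_nonempty fun i _ =>
        AgentDemand.total_lt hA hE hF hp (hxd i) (hyd i) h
      exact absurd (hys.trans hxs.symm) this.ne
    · exact h
    · have := Finset.sum_lt_sum_of_nonempty Finset.univ_nonempty fun i _ =>
        AgentDemand.total_lt hA hE hF hp (hyd i) (hxd i) h
      exact absurd (hxs.trans hys.symm) this.ne
  have key := fun i => AgentDemand.unique hA hE hF hp (hxd i) (hR ▸ hyd i)
  ext i
  · exact (key i).1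
  · exact (key i).2.1
  · exact (key i).2.2
  · rw [hxb, hyb, (key i).1, (key i).2.2]
  · exact hR

/-! ### Continuity of equilibrium in the policy -/

/-- If the return `r` exceeds some marginal product of every agent at the policy `p`, then demands
at `r` exist for all policies near `p`, and date-0 excess demand at `r` is continuous at `p`. -/
theorem eventually_exists_demand (hp : p ∈ admissiblePolicies) {r : ℝ} {z : Fin m → ℝ}
    (hz : ∀ i, 0 < z i) (hr : ∀ i, E.prod i p.2.2 * deriv (E.F i) (z i) < r) :
    ∃ c₀ c₁ k : (ℝ × ℝ × ℝ) → Fin m → ℝ,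
      (∀ i, E.AgentDemand i p r (c₀ p i) (c₁ p i) (k p i)) ∧
      (∀ᶠ q in 𝓝[admissiblePolicies] p, ∀ i, E.AgentDemand i q r (c₀ q i) (c₁ q i) (k q i)) ∧
      Tendsto (fun q => ∑ i, (c₀ q i + k q i) - ∑ i, E.income₀ i q.1) (𝓝[admissiblePolicies] p)
        (𝓝 (∑ i, (c₀ p i + k p i) - ∑ i, E.income₀ i p.1)) := by
  have hmem : ∀ᶠ q in 𝓝[admissiblePolicies] p, q ∈ admissiblePolicies := eventually_mem_nhdsWithin
  have hid : Tendsto (fun q => q) (𝓝[admissiblePolicies] p) (𝓝 p) := nhdsWithin_le_nhds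
  have hex : ∀ q i, ∃ y : ℝ × ℝ × ℝ, q ∈ admissiblePolicies →
      E.prod i q.2.2 * deriv (E.F i) (z i) < r → E.AgentDemand i q r y.1 y.2.1 y.2.2 := by
    intro q i
    by_cases h : q ∈ admissiblePolicies ∧ E.prod i q.2.2 * deriv (E.F i) (z i) < r
    · obtain ⟨c₀, c₁, k, hd⟩ := AgentDemand.exists_of_le hA hE hF h.1 (hz i) h.2.le
      exact ⟨(c₀, c₁, k), fun _ _ => hd⟩
    · exact ⟨0, fun h1 h2 => absurd ⟨h1, h2⟩ h⟩
  choose y hy using hex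
  have hev : ∀ᶠ q in 𝓝[admissiblePolicies] p, ∀ i,
      E.AgentDemand i q r (y q i).1 (y q i).2.1 (y q i).2.2 := by
    refine eventually_all.2 fun i => ?_
    have := ((tendsto_prod hA i hp hmem hid).mul_const
      (deriv (E.F i) (z i))).eventually_lt_const (hr i)
    filter_upwards [hmem, this] with q h1 h2 using hy q i h1 h2
  have hat := fun i => hy p i hp (hr i)
  refine ⟨fun q i => (y q i).1, fun q i => (y q i).2.1, fun q i => (y q i).2.2, hat, hev, ?_⟩
  refine Tendsto.sub (tendsto_finsetSum _ fun i _ => ?_) (tendsto_finsetSum _ fun i _ => ?_)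
  · have := AgentDemand.tendsto hA hE hF hp hmem hid tendsto_const_nhds
      (hev.mono fun q hq => hq i) (hat i)
    exact this.1.add this.2.2
  · exact ((continuous_fst.continuousAt.tendsto.comp hid).const_mul _).const_add _

/-- The equilibrium return is continuous in the policy. -/
theorem tendsto_equilibrium_R (hm : 0 < m) (hp : p ∈ admissiblePolicies)
    {e : ℝ × ℝ × ℝ → Outcome m}
    (he : ∀ q ∈ admissiblePolicies, E.IsCompetitiveEquilibrium q.1 q.2.1 q.2.2 (e q)) :
    Tendsto (fun q => (e q).R) (𝓝[admissiblePolicies] p) (𝓝 (e p).R) := by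
  have : Nonempty (Fin m) := ⟨⟨0, hm⟩⟩
  have hmem : ∀ᶠ q in 𝓝[admissiblePolicies] p, q ∈ admissiblePolicies := eventually_mem_nhdsWithin
  have heq := fun q hq => (isCompetitiveEquilibrium_iff hm hA hE hF hq).1 (he q hq)
  obtain ⟨hd, -, hs⟩ := heq p hp
  refine tendsto_order.2 ⟨fun r hr => ?_, fun r hr => ?_⟩
  · have hz : ∀ i, E.prod i p.2.2 * deriv (E.F i) ((e p).k i + 1) < (e p).R := fun i => by
      rw [← (hd i).marginal_product]
      exact mul_lt_mul_of_pos_left ((isTechnology_F hE hF i).marginal.lt_of_lt (hd i).k_pos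
        (by linarith)) (prod_pos hA hE i hp.2.2.1)
    obtain ⟨j, hj⟩ := Finite.exists_max fun i =>
      E.prod i p.2.2 * deriv (E.F i) ((e p).k i + 1)
    obtain ⟨t, ht, htR⟩ := exists_between (max_lt hr (hz j))
    obtain ⟨c₀, c₁, k, hat, hev, hlim⟩ := eventually_exists_demand hA hE hF hp (r := t)
      (z := fun i => (e p).k i + 1) (fun i => add_pos (hd i).k_pos one_pos)
      fun i => (hj i).trans_lt ((le_max_right _ _).trans_lt ht)
    have hpos := Finset.sum_lt_sum_of_nonempty Finset.univ_nonempty fun i _ =>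
      AgentDemand.total_lt hA hE hF hp (hat i) (hd i) htR
    rw [hs] at hpos
    filter_upwards [hmem, hev, hlim.eventually_const_lt (sub_pos.2 hpos)] with q hq h1 h2
    refine ((le_max_left _ _).trans_lt ht).trans_le ?_
    by_contra! hlt
    obtain ⟨hqd, -, hqs⟩ := heq q hq
    have := Finset.sum_lt_sum_of_nonempty Finset.univ_nonempty fun i _ =>
      AgentDemand.total_lt hA hE hF hq (hqd i) (h1 i) hlt
    linarith
  -- Above equilibrium the equilibrium investments themselves serve as `z`, since their marginal
  -- products equal the equilibrium return.
  · obtain ⟨t, hRt, htr⟩ := exists_between hr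
    obtain ⟨c₀, c₁, k, hat, hev, hlim⟩ := eventually_exists_demand hA hE hF hp (r := t)
      (z := (e p).k) (fun i => (hd i).k_pos) fun i => by rw [(hd i).marginal_product]; exact hRt
    have hneg := Finset.sum_lt_sum_of_nonempty Finset.univ_nonempty fun i _ =>
      AgentDemand.total_lt hA hE hF hp (hd i) (hat i) hRt
    rw [hs] at hneg
    filter_upwards [hmem, hev, hlim.eventually_lt_const (sub_neg.2 hneg)] with q hq h1 h2
    refine lt_of_le_of_lt ?_ htr
    by_contra! hlt
    obtain ⟨hqd, -, hqs⟩ := heq q hq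
    have := Finset.sum_lt_sum_of_nonempty Finset.univ_nonempty fun i _ =>
      AgentDemand.total_lt hA hE hF hq (h1 i) (hqd i) hlt
    linarith

end Demand

end Economy

open Economy

theorem proposition1 {m : ℕ} (hm : 0 < m) (E : Economy m)
    (hA : E.ProductivityAssumption) (hE : E.AgentAssumption) (hF : E.AdditionalAssumption) :
    (∀ T₀ T₁ D₀ : ℝ, (T₀, T₁, D₀) ∈ admissiblePolicies →
      ∃! x : Outcome m, E.IsCompetitiveEquilibrium T₀ T₁ D₀ x) ∧
    (∀ e : ℝ × ℝ × ℝ → Outcome m,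
      (∀ T₀ T₁ D₀ : ℝ, (T₀, T₁, D₀) ∈ admissiblePolicies →
        E.IsCompetitiveEquilibrium T₀ T₁ D₀ (e (T₀, T₁, D₀))) →
      ContinuousOn (fun p => (e p).c₀) admissiblePolicies ∧
      ContinuousOn (fun p => (e p).c₁) admissiblePolicies ∧
      ContinuousOn (fun p => (e p).k) admissiblePolicies ∧
      ContinuousOn (fun p => (e p).b) admissiblePolicies ∧
      ContinuousOn (fun p => (e p).R) admissiblePolicies) := by
  refine ⟨fun T₀ T₁ D₀ hp => ?_, fun e he => ?_⟩
  · obtain ⟨x, hx⟩ := exists_isCompetitiveEquilibrium hA hE hF hm hp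
    exact ⟨x, hx, fun y hy => isCompetitiveEquilibrium_unique hA hE hF hm hp hy hx⟩
  have he' : ∀ q ∈ admissiblePolicies, E.IsCompetitiveEquilibrium q.1 q.2.1 q.2.2 (e q) :=
    fun q hq => he q.1 q.2.1 q.2.2 hq
  have heq := fun q hq => (isCompetitiveEquilibrium_iff hm hA hE hF hq).1 (he' q hq)
  have hR : ContinuousOn (fun p => (e p).R) admissiblePolicies := fun p hp =>
    tendsto_equilibrium_R hA hE hF hm hp he'
  have key := fun p (hp : p ∈ admissiblePolicies) i =>
    AgentDemand.tendsto hA hE hF (i := i) (l := 𝓝[admissiblePolicies] p) (q := fun q => q) hp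
      eventually_mem_nhdsWithin nhdsWithin_le_nhds (hR p hp)
      (eventually_mem_nhdsWithin.mono fun q hq => (heq q hq).1 i) ((heq p hp).1 i)
  refine ⟨fun p hp => tendsto_pi_nhds.2 fun i => (key p hp i).1,
    fun p hp => tendsto_pi_nhds.2 fun i => (key p hp i).2.1,
    fun p hp => tendsto_pi_nhds.2 fun i => (key p hp i).2.2,
    fun p hp => tendsto_pi_nhds.2 fun i => ?_, hR⟩
  have hinc : Tendsto (fun q : ℝ × ℝ × ℝ => E.income₀ i q.1) (𝓝[admissiblePolicies] p)
      (𝓝 (E.income₀ i p.1)) :=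
    ((continuous_fst.continuousAt.tendsto.mono_left nhdsWithin_le_nhds).const_mul _).const_add _
  change Tendsto _ _ (𝓝 ((e p).b i))
  rw [(heq p hp).2.1 i]
  refine (((key p hp i).1.add (key p hp i).2.2).sub hinc).congr' ?_
  exact eventually_mem_nhdsWithin.mono fun q hq => ((heq q hq).2.1 i).symm
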